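/- Let $\Sigma$ be a nonempty set (of labels). A weak transition system consists of a set $S$ of states, a set $L$ of actions, a labelling map $\mu:L\to\Sigma$, and for each $n\ge 1$ a set $T_n\subseteq S\times L^n\times S$ of $n$-transitions (a transition is an element of $T=\bigcup_{n\ge1}T_n$), such that: - (Multiset axiom) if $(\alpha,u_1,\dots,u_n,\beta)$ is a transition and $\sigma$ is a permutation of $\{1,\dots,n\}$, then $(\alpha,u_{\sigma(1)},\dots,u_{\sigma(n)},\beta)$ is a transition; - (Patching axiom) if $n\ge 3$, $p,q\ge1$, $p+q<n$, and $(\alpha,u_1,\dots,u_n,\beta)$, $(\alpha,u_1,\dots,u_p,\nu_1)$, $(\nu_1,u_{p+1},\dots,u_n,\beta)$, $(\alpha,u_1,\dots,u_{p+q},\nu_2)$, $(\nu_2,u_{p+q+1},\dots,u_n,\beta)$ are all transitions, then $(\nu_1,u_{p+1},\dots,u_{p+q},\nu_2)$ is a transition. A map of weak transition systems $(S,\mu:L\to\Sigma,T)\to(S',\mu':L'\to\Sigma,T')$ is a pair of maps $f_0:S\to S'$, $\widetilde f:L\to L'$ such that $\mu'\circ\widetilde f=\mu$ and such that $(f_0(\alpha),\widetilde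 f(u_1),\dots,\widetilde f(u_n),f_0(\beta))\in T'$ whenever $(\alpha,u_1,\dots,u_n,\beta)\in T$. This gives the category $\mathcal{WTS}$. Let $\{\iota\}$ be the weak transition system with one state $\iota$, no actions and no transitions. Let $\mathcal{WTS}_\bullet$ be the category of star-shaped weak transition systems, that is, the full subcategory of the comma category $\{\iota\}\downarrow\mathcal{WTS}$ consisting of the objects $\{\iota\}\to X$ such that every state of $X$ is reachable from the image of $\iota$ by a finite (possibly empty) path of transitions of $X$. Then the category $\mathcal{WTS}_\bullet$ is locally presentable. -/

import Mathlib

open CategoryTheory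

universe u

/-- A weak transition system over the set of labels `Lab`. An `n`-tuple `(u₁, …, uₙ)` of actions is
the list `[u₁, …, uₙ]`, and `Trans α [u₁, …, uₙ] β` says that `(α, u₁, …, uₙ, β)` is a transition;
there are no transitions of dimension `0`. -/
structure WTS (Lab : Type u) : Type (u + 1) where
  State : Type u
  Action : Type u
  label : Action → Lab
  Trans : State → List Action → State → Prop
  ne_nil : ∀ {α l β}, Trans α l β → l ≠ []
  /-- The multiset axiom. -/
  multiset : ∀ {α l l' β}, l.Perm l' → Trans α l β → Trans α l' β
  /-- The patching axiom, for the tuple `x ++ y ++ z` cut into three nonempty pieces (of lengths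
  `p`, `q` and `n - p - q`). -/
  patching : ∀ {α β ν₁ ν₂ : State} {x y z : List Action}, x ≠ [] → y ≠ [] → z ≠ [] →
    Trans α (x ++ y ++ z) β →
    Trans α x ν₁ → Trans ν₁ (y ++ z) β →
    Trans α (x ++ y) ν₂ → Trans ν₂ z β →
    Trans ν₁ y ν₂

namespace WTS

variable {Lab : Type u}

/-- A map of weak transition systems. -/
@[ext]
structure Hom (X Y : WTS Lab) : Type u where
  onState : X.State → Y.State
  onAction : X.Action → Y.Action
  label_comp : ∀ a, Y.label (onAction a) = X.label a
  map_trans : ∀ {α l β}, X.Trans α l β → Y.Trans (onState α) (l.map onAction) (onState β)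

instance : Category.{u} (WTS Lab) where
  Hom := Hom
  id X :=
    { onState := id
      onAction := id
      label_comp := fun _ => rfl
      map_trans := fun h => by simpa using h }
  comp f g :=
    { onState := g.onState ∘ f.onState
      onAction := g.onAction ∘ f.onAction
      label_comp := fun a => (g.label_comp _).trans (f.label_comp a)
      map_trans := fun h => by simpa using g.map_trans (f.map_trans h) }

/-- The weak transition system with set of states `S`, no actions and no transitions. -/
def ofSet (Lab : Type u) (S : Type u) : WTS Lab where
  State := S
  Action := PEmpty
  label := PEmpty.elim
  Trans := fun _ _ _ => False
  ne_nil := False.elim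
  multiset := fun _ h => h
  patching := fun _ _ _ h _ _ _ _ => h

/-- The weak transition system `{ι}`. -/
abbrev point (Lab : Type u) : WTS Lab := ofSet Lab PUnit.{u + 1}

/-- `β` is reachable from `α`: there is a finite, possibly empty, path of transitions of any
dimensions from `α` to `β`. -/
def Reachable (X : WTS Lab) (α β : X.State) : Prop :=
  Relation.ReflTransGen (fun γ δ => ∃ l, X.Trans γ l δ) α β

/-- The initial state of an object `{ι} ⟶ X` of the comma category `{ι} ↓ WTS`: the image
of `ι`. -/
def initialState (X : Under (point Lab)) : X.right.State :=
  Hom.onState X.hom PUnit.unit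

/-- The objects `{ι} ⟶ X` of `{ι} ↓ WTS` such that every state of `X` is reachable from the
initial state. -/
def IsStarShaped (Lab : Type u) : ObjectProperty (Under (point Lab)) :=
  fun X => ∀ α : X.right.State, X.right.Reachable (initialState X) α

end WTS

/-- The category of star-shaped weak transition systems, a full subcategory of `{ι} ↓ WTS`. -/
abbrev StarWTS (Lab : Type u) : Type (u + 1) := (WTS.IsStarShaped Lab).FullSubcategory

/-!
The category of star-shaped weak transition systems is locally `ℵ₁`-presentable: it is cocomplete,
and the systems with countably many states and actions form an essentially small family of
`ℵ₁`-presentable objects of which every object is an `ℵ₁`-directed colimit.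

*Colimits.* The states and the actions of a colimit are quotients of disjoint unions, with an extra
state identified with all the initial ones, so that the empty diagram causes no trouble. Its
transitions are those generated, under the multiset and patching axioms, by the images of the
transitions of the diagram (`WTS.generate`). Every state comes from an object of the diagram, hence
is reachable there, so the colimit is star-shaped (`StarWTS.colimitStar`).

*Presentability.* Along an `ℵ₁`-filtered diagram nothing has to be generated: a configuration of
the patching axiom involves finitely many states and actions and so lives at one stage, where the
axiom holds (`StarWTS.imageTrans_of_generated`). Hence a tuple which is a transition in the colimit
is already one at some stage (`StarWTS.exists_trans_of_trans`). A countable system has countably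
many transitions, since these are indexed by finite lists, so countably many conditions decide
whether maps on its states and actions form a morphism, and all of them can be met at one stage
(`StarWTS.isCardinalPresentable_of_countable`).

*Generation.* Every state of a star-shaped system is reached by a finite path. Therefore countably
many states and actions lie in a countable full subsystem which is itself star-shaped
(`StarWTS.CountableSub.exists_subset`): add the states and the actions of one path to each state.
These subsystems form an `ℵ₁`-directed poset, every transition lies in one of them, and their
colimit is the given system (`StarWTS.CountableSub.isColimitCocone`).
-/

/-! ### Transition systems and their maps -/

namespace WTS

variable {Lab : Type u}

/-- Reachability is preserved by maps of weak transition systems. -/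
lemma Reachable.map {X Y : WTS Lab} (f : Hom X Y) {α β : X.State} (h : X.Reachable α β) :
    Y.Reachable (f.onState α) (f.onState β) :=
  Relation.ReflTransGen.lift (r := fun γ δ => ∃ l, X.Trans γ l δ) f.onState
    (fun _ _ ⟨_, hl⟩ => ⟨_, f.map_trans hl⟩) _ _ h

/-- The transitions generated by a relation `T` under the multiset and patching axioms. -/
inductive Generated {S L : Type u} (T : S → List L → S → Prop) : S → List L → S → Prop
  | of {α l β} : T α l β → Generated T α l β
  | multiset {α l l' β} : l.Perm l' → Generated T α l β → Generated T α l' β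
  | patching {α β ν₁ ν₂ : S} {x y z : List L} : x ≠ [] → y ≠ [] → z ≠ [] →
      Generated T α (x ++ y ++ z) β → Generated T α x ν₁ → Generated T ν₁ (y ++ z) β →
      Generated T α (x ++ y) ν₂ → Generated T ν₂ z β → Generated T ν₁ y ν₂

/-- The weak transition system with prescribed states, actions and labels whose transitions are
generated by `T`. -/
def generate {S L : Type u} (label : L → Lab) (T : S → List L → S → Prop)
    (hT : ∀ {α l β}, T α l β → l ≠ []) : WTS Lab where
  State := S
  Action := L
  label := label
  Trans := Generated T
  ne_nil h := by
    induction h with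
    | of h => exact hT h
    | multiset h _ ih => exact fun h' => ih (by subst h'; exact h.eq_nil)
    | patching _ hy => exact hy
  multiset := .multiset
  patching := .patching

/-- The weak transition system induced on `S` and `L` by maps to the states and actions of `X`:
a tuple is a transition if its image in `X` is one. -/
def induced (X : WTS Lab) {S L : Type u} (g : S → X.State) (h : L → X.Action) : WTS Lab where
  State := S
  Action := L
  label a := X.label (h a)
  Trans α l β := X.Trans (g α) (l.map h) (g β)
  ne_nil h' := by simpa using X.ne_nil h'
  multiset p := X.multiset (p.map h)
  patching hx hy hz h₁ h₂ h₃ h₄ h₅ := by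
    simp only [List.map_append] at h₁ h₃ h₄
    exact X.patching (by simpa using hx) (by simpa using hy) (by simpa using hz) h₁ h₂ h₃ h₄ h₅

/-- If `T`-related tuples go to transitions of `Y`, so do the tuples generated by `T`. -/
lemma Generated.map {S L : Type u} {T : S → List L → S → Prop} {Y : WTS Lab}
    {g : S → Y.State} {h : L → Y.Action}
    (hT : ∀ {α l β}, T α l β → Y.Trans (g α) (l.map h) (g β)) {α l β}
    (H : Generated T α l β) : Y.Trans (g α) (l.map h) (g β) := by
  induction H with
  | of h' => exact hT h'
  | multiset p _ ih => exact Y.multiset (p.map h) ih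
  | patching hx hy hz _ _ _ _ _ h₁ h₂ h₃ h₄ h₅ =>
    exact (Y.induced g h).patching hx hy hz h₁ h₂ h₃ h₄ h₅

end WTS

/-! ### Objects and morphisms of the category of star-shaped systems -/

namespace StarWTS

variable {Lab : Type u}

/-- The weak transition system underlying a star-shaped one. -/
abbrev toWTS (X : StarWTS Lab) : WTS Lab := X.obj.right

/-- The initial state of a star-shaped weak transition system. -/
abbrev base (X : StarWTS Lab) : X.toWTS.State := WTS.initialState X.obj

/-- The map of weak transition systems underlying a morphism. -/
def toHom {X Y : StarWTS Lab} (f : X ⟶ Y) : WTS.Hom X.toWTS Y.toWTS := f.hom.right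

/-- The star-shaped weak transition system given by a system and an initial state from which
every state is reachable. -/
def of (X : WTS Lab) (i : X.State) (h : ∀ α, X.Reachable i α) : StarWTS Lab :=
  ⟨Under.mk (Y := X) (X := WTS.point Lab)
    { onState := fun _ => i
      onAction := PEmpty.elim
      label_comp := fun a => a.elim
      map_trans := False.elim }, h⟩

lemma toHom_base {X Y : StarWTS Lab} (f : X ⟶ Y) : (toHom f).onState X.base = Y.base :=
  congrArg (fun g : WTS.point Lab ⟶ Y.toWTS => WTS.Hom.onState g PUnit.unit) (Under.w f.hom)

/-- A morphism of star-shaped weak transition systems is a map preserving the initial state. -/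
def homMk {X Y : StarWTS Lab} (f : WTS.Hom X.toWTS Y.toWTS)
    (hf : f.onState X.base = Y.base) : X ⟶ Y :=
  ObjectProperty.homMk (Under.homMk f
    (WTS.Hom.ext (funext fun _ => hf) (funext fun a => PEmpty.elim a)))

lemma hom_ext {X Y : StarWTS Lab} {f g : X ⟶ Y}
    (h₁ : ∀ s, (toHom f).onState s = (toHom g).onState s)
    (h₂ : ∀ a, (toHom f).onAction a = (toHom g).onAction a) : f = g := by
  apply ObjectProperty.hom_ext
  apply Under.UnderMorphism.ext
  exact WTS.Hom.ext (funext h₁) (funext h₂)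

@[simp]
lemma onState_comp {X Y Z : StarWTS Lab} (f : X ⟶ Y) (g : Y ⟶ Z) (s : X.toWTS.State) :
    (toHom (f ≫ g)).onState s = (toHom g).onState ((toHom f).onState s) := rfl

@[simp]
lemma onAction_comp {X Y Z : StarWTS Lab} (f : X ⟶ Y) (g : Y ⟶ Z) (a : X.toWTS.Action) :
    (toHom (f ≫ g)).onAction a = (toHom g).onAction ((toHom f).onAction a) := rfl

@[simp]
lemma onState_id (X : StarWTS Lab) (s : X.toWTS.State) : (toHom (𝟙 X)).onState s = s := rfl

@[simp]
lemma onAction_id (X : StarWTS Lab) (a : X.toWTS.Action) : (toHom (𝟙 X)).onAction a = a := rfl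

variable (Lab) in
/-- The functor sending a star-shaped system to its set of states. -/
def stateFunctor : StarWTS Lab ⥤ Type u where
  obj X := X.toWTS.State
  map f := ↾ (toHom f).onState

variable (Lab) in
/-- The functor sending a star-shaped system to its set of actions. -/
def actionFunctor : StarWTS Lab ⥤ Type u where
  obj X := X.toWTS.Action
  map f := ↾ (toHom f).onAction

/-! ### Colimits -/

section Colimits

open Limits

variable {J : Type u} [SmallCategory J] (F : J ⥤ StarWTS Lab)

/-- The identifications made between the states of a diagram, together with an extra point
`none`, which stands for the initial state. -/
inductive StateRel : Option (Σ j, (F.obj j).toWTS.State) →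
    Option (Σ j, (F.obj j).toWTS.State) → Prop
  | base (j : J) : StateRel none (some ⟨j, (F.obj j).base⟩)
  | map {j k : J} (f : j ⟶ k) (s : (F.obj j).toWTS.State) :
      StateRel (some ⟨j, s⟩) (some ⟨k, (toHom (F.map f)).onState s⟩)

/-- The identifications made between the actions of a diagram. -/
inductive ActionRel : (Σ j, (F.obj j).toWTS.Action) → (Σ j, (F.obj j).toWTS.Action) → Prop
  | map {j k : J} (f : j ⟶ k) (a : (F.obj j).toWTS.Action) :
      ActionRel ⟨j, a⟩ ⟨k, (toHom (F.map f)).onAction a⟩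

/-- The class of a state of one of the objects of a diagram. -/
def mkState (j : J) (s : (F.obj j).toWTS.State) : Quot (StateRel F) := Quot.mk _ (some ⟨j, s⟩)

/-- The class of an action of one of the objects of a diagram. -/
def mkAction (j : J) (a : (F.obj j).toWTS.Action) : Quot (ActionRel F) := Quot.mk _ ⟨j, a⟩

lemma mkState_map {j k : J} (f : j ⟶ k) (s : (F.obj j).toWTS.State) :
    mkState F k ((toHom (F.map f)).onState s) = mkState F j s :=
  (Quot.sound (.map f s)).symm

lemma mkAction_map {j k : J} (f : j ⟶ k) (a : (F.obj j).toWTS.Action) :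
    mkAction F k ((toHom (F.map f)).onAction a) = mkAction F j a :=
  (Quot.sound (.map f a)).symm

/-- The images, in the quotients, of the transitions of the objects of a diagram. -/
inductive ImageTrans : Quot (StateRel F) → List (Quot (ActionRel F)) → Quot (StateRel F) → Prop
  | mk {j : J} {α l β} : (F.obj j).toWTS.Trans α l β →
      ImageTrans (mkState F j α) (l.map (mkAction F j)) (mkState F j β)

/-- The weak transition system underlying the colimit of a diagram. -/
def colimitWTS : WTS Lab :=
  WTS.generate
    (Quot.lift (fun a : Σ j, (F.obj j).toWTS.Action => (F.obj a.1).toWTS.label a.2) (by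
      rintro _ _ ⟨f, a⟩
      exact ((toHom (F.map f)).label_comp a).symm))
    (ImageTrans F) (by
      rintro _ _ _ ⟨h⟩
      simpa using (F.obj _).toWTS.ne_nil h)

/-- The map from an object of a diagram to the colimit. -/
def toColimitWTS (j : J) : WTS.Hom (F.obj j).toWTS (colimitWTS F) where
  onState := mkState F j
  onAction := mkAction F j
  label_comp _ := rfl
  map_trans h := .of (.mk h)

/-- The colimit of a diagram of star-shaped weak transition systems. -/
def colimitStar : StarWTS Lab :=
  of (colimitWTS F) (Quot.mk _ none) (by
    rintro ⟨_ | ⟨j, s⟩⟩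
    · exact Relation.ReflTransGen.refl
    · have h := ((F.obj j).property s).map (toColimitWTS F j)
      have h' : (Quot.mk _ none : Quot (StateRel F)) = mkState F j (F.obj j).base :=
        Quot.sound (.base j)
      rw [h']
      exact h)

/-- The colimit cocone of a diagram of star-shaped weak transition systems. -/
def colimitCocone : Cocone F where
  pt := colimitStar F
  ι :=
    { app j := homMk (toColimitWTS F j) (Quot.sound (.base j)).symm
      naturality _ _ f := hom_ext (mkState_map F f) (mkAction_map F f) }

/-- The map out of the states of the colimit induced by a cocone. -/
def descState (s : Cocone F) : Quot (StateRel F) → s.pt.toWTS.State :=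
  Quot.lift (fun x => x.elim s.pt.base fun x => (toHom (s.ι.app x.1)).onState x.2) (by
    rintro _ _ (⟨j⟩ | ⟨f, x⟩)
    · exact (toHom_base (s.ι.app j)).symm
    · exact (congrArg (fun g => (toHom g).onState x) (s.w f)).symm)

/-- The map out of the actions of the colimit induced by a cocone. -/
def descAction (s : Cocone F) : Quot (ActionRel F) → s.pt.toWTS.Action :=
  Quot.lift (fun x => (toHom (s.ι.app x.1)).onAction x.2) (by
    rintro _ _ ⟨f, x⟩
    exact (congrArg (fun g => (toHom g).onAction x) (s.w f)).symm)

/-- The map out of the colimit induced by a cocone. -/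
def colimitDesc (s : Cocone F) : colimitStar F ⟶ s.pt :=
  homMk
    { onState := descState F s
      onAction := descAction F s
      label_comp := by
        rintro ⟨j, a⟩
        exact (toHom (s.ι.app j)).label_comp a
      map_trans := fun h => WTS.Generated.map (by
        rintro _ _ _ ⟨h⟩
        have h' := (toHom (s.ι.app _)).map_trans h
        rw [show (toHom (s.ι.app _)).onAction = descAction F s ∘ mkAction F _ from rfl,
          ← List.map_map] at h'
        exact h') h } rfl

/-- The cocone `colimitCocone` is universal. -/
def isColimitColimitCocone : IsColimit (colimitCocone F) where
  desc := colimitDesc F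
  fac _ _ := rfl
  uniq s m hm := hom_ext
    (by
      rintro ⟨_ | ⟨j, x⟩⟩
      · exact toHom_base m
      · exact congrArg (fun g => (toHom g).onState x) (hm j))
    (by
      rintro ⟨j, x⟩
      exact congrArg (fun g => (toHom g).onAction x) (hm j))

instance : HasColimitsOfSize.{u, u} (StarWTS Lab) where
  has_colimits_of_shape _ _ :=
    { has_colimit F := ⟨⟨_, isColimitColimitCocone F⟩⟩ }

end Colimits

/-! ### Filtered colimits -/

section FilteredColimits

open Limits Cardinal

variable {J : Type u} [SmallCategory J] {F : J ⥤ StarWTS Lab}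

variable (F) in
/-- In a connected diagram the extra point is identified with all the initial states, so that the
states of the colimit are the colimit of the states. -/
noncomputable def isColimitState [IsFiltered J] :
    IsColimit ((stateFunctor Lab).mapCocone (colimitCocone F)) where
  desc s := ↾ Quot.lift
    (fun x => x.elim (s.ι.app (IsFiltered.nonempty (C := J)).some (F.obj _).base) fun x =>
      s.ι.app x.1 x.2) (by
      have key {j k : J} (f : j ⟶ k) (x) :
          s.ι.app k ((toHom (F.map f)).onState x) = s.ι.app j x :=
        ConcreteCategory.congr_hom (s.w f) x
      rintro _ _ (⟨j⟩ | ⟨f, x⟩)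
      · change s.ι.app (IsFiltered.nonempty (C := J)).some (F.obj _).base =
          s.ι.app j (F.obj j).base
        rw [← key (IsFiltered.leftToMax _ j), ← key (IsFiltered.rightToMax _ j), toHom_base,
          toHom_base]
      · exact (key f x).symm)
  fac _ _ := rfl
  uniq s m hm := by
    ext x
    rcases x with ⟨_ | ⟨j, x⟩⟩
    · refine Eq.trans ?_ (ConcreteCategory.congr_hom (hm (IsFiltered.nonempty (C := J)).some) _)
      exact congrArg m (Quot.sound (.base _))
    · exact ConcreteCategory.congr_hom (hm j) x

variable (F) in
/-- The actions of a colimit are the colimit of the actions. -/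
def isColimitAction :
    IsColimit ((actionFunctor Lab).mapCocone (colimitCocone F)) where
  desc s := ↾ Quot.lift (fun x => s.ι.app x.1 x.2) (by
    rintro _ _ ⟨f, x⟩
    exact (ConcreteCategory.congr_hom (s.w f) x).symm)
  fac _ _ := rfl
  uniq s m hm := by
    ext x
    rcases x with ⟨j, x⟩
    exact ConcreteCategory.congr_hom (hm j) x

instance [IsFiltered J] : PreservesColimitsOfShape J (stateFunctor Lab) where
  preservesColimit {F} :=
    preservesColimit_of_preserves_colimit_cocone (isColimitColimitCocone F) (isColimitState F)

instance : PreservesColimitsOfShape J (actionFunctor Lab) where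
  preservesColimit {F} :=
    preservesColimit_of_preserves_colimit_cocone (isColimitColimitCocone F) (isColimitAction F)

instance : Fact (ℵ₁ : Cardinal.{u}).IsRegular := ⟨isRegular_aleph_one⟩

lemma hasCardinalLT_aleph_one (K : Type*) [Countable K] :
    HasCardinalLT K (ℵ₁ : Cardinal.{u}) := by
  rw [HasCardinalLT, lift_aleph, Ordinal.lift_one, lt_aleph_one_iff, lift_le_aleph0]
  exact mk_le_aleph0

/-- In an `ℵ₁`-filtered category, countably many conditions on the arrows out of `j`, each of
which can be fulfilled and then remains so, can be fulfilled by a single arrow. -/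
lemma exists_forall_of_forall_exists [IsCardinalFiltered J (ℵ₁ : Cardinal.{u})]
    {K : Type*} [Countable K] (j : J) (Q : K → ∀ k, (j ⟶ k) → Prop)
    (hQ : ∀ i k l (f : j ⟶ k) (g : k ⟶ l), Q i k f → Q i l (f ≫ g))
    (h : ∀ i, ∃ k f, Q i k f) : ∃ k f, ∀ i, Q i k f := by
  choose k f hf using h
  obtain ⟨m, a, b, hab⟩ :=
    IsCardinalFiltered.wideSpan (κ := (ℵ₁ : Cardinal.{u})) f (hasCardinalLT_aleph_one K)
  exact ⟨m, b, fun i => hab i ▸ hQ i _ _ _ (a i) (hf i)⟩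

section

variable {c : Cocone F}

lemma onState_w {j k : J} (f : j ⟶ k) (s : (F.obj j).toWTS.State) :
    (toHom (c.ι.app k)).onState ((toHom (F.map f)).onState s) = (toHom (c.ι.app j)).onState s :=
  congrArg (fun g => (toHom g).onState s) (c.w f)

lemma onAction_w {j k : J} (f : j ⟶ k) (a : (F.obj j).toWTS.Action) :
    (toHom (c.ι.app k)).onAction ((toHom (F.map f)).onAction a) =
      (toHom (c.ι.app j)).onAction a :=
  congrArg (fun g => (toHom g).onAction a) (c.w f)

lemma map_onAction_w {j k : J} (f : j ⟶ k) (l : List (F.obj j).toWTS.Action) :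
    (l.map (toHom (F.map f)).onAction).map (toHom (c.ι.app k)).onAction =
      l.map (toHom (c.ι.app j)).onAction := by
  rw [List.map_map]
  exact List.map_congr_left fun a _ => onAction_w f a

lemma onState_map_comp {i j k : J} (f : i ⟶ j) (g : j ⟶ k) (s : (F.obj i).toWTS.State) :
    (toHom (F.map (f ≫ g))).onState s =
      (toHom (F.map g)).onState ((toHom (F.map f)).onState s) := by
  rw [F.map_comp, onState_comp]

lemma onAction_map_comp {i j k : J} (f : i ⟶ j) (g : j ⟶ k) (a : (F.obj i).toWTS.Action) :
    (toHom (F.map (f ≫ g))).onAction a =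
      (toHom (F.map g)).onAction ((toHom (F.map f)).onAction a) := by
  rw [F.map_comp, onAction_comp]

lemma map_onAction_map_comp {i j k : J} (f : i ⟶ j) (g : j ⟶ k)
    (l : List (F.obj i).toWTS.Action) :
    l.map (toHom (F.map (f ≫ g))).onAction =
      (l.map (toHom (F.map f)).onAction).map (toHom (F.map g)).onAction := by
  rw [List.map_map]
  exact List.map_congr_left fun a _ => onAction_map_comp f g a


variable [IsCardinalFiltered J (ℵ₁ : Cardinal.{u})] (hc : IsColimit c)

include hc

lemma onState_eq_iff {j : J} (x y : (F.obj j).toWTS.State) :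
    (toHom (c.ι.app j)).onState x = (toHom (c.ι.app j)).onState y ↔
      ∃ (k : J) (f : j ⟶ k), (toHom (F.map f)).onState x = (toHom (F.map f)).onState y :=
  have := isFiltered_of_isCardinalFiltered J (ℵ₁ : Cardinal.{u})
  Types.FilteredColimit.isColimit_eq_iff' (isColimitOfPreserves (stateFunctor Lab) hc) x y

lemma onAction_eq_iff {j : J} (x y : (F.obj j).toWTS.Action) :
    (toHom (c.ι.app j)).onAction x = (toHom (c.ι.app j)).onAction y ↔
      ∃ (k : J) (f : j ⟶ k), (toHom (F.map f)).onAction x = (toHom (F.map f)).onAction y :=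
  have := isFiltered_of_isCardinalFiltered J (ℵ₁ : Cardinal.{u})
  Types.FilteredColimit.isColimit_eq_iff' (isColimitOfPreserves (actionFunctor Lab) hc) x y

/-- Countably many states and actions of an `ℵ₁`-filtered colimit come from a common stage. -/
lemma exists_stage {K K' : Type*} [Countable K] [Countable K'] (s : K → c.pt.toWTS.State)
    (a : K' → c.pt.toWTS.Action) :
    ∃ (j : J) (s' : K → (F.obj j).toWTS.State) (a' : K' → (F.obj j).toWTS.Action),
      (∀ i, (toHom (c.ι.app j)).onState (s' i) = s i) ∧
        ∀ i, (toHom (c.ι.app j)).onAction (a' i) = a i := by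
  have := isFiltered_of_isCardinalFiltered J (ℵ₁ : Cardinal.{u})
  choose j₁ s' hs using fun i => Types.jointly_surjective_of_isColimit
    (isColimitOfPreserves (stateFunctor Lab) hc) (s i)
  choose j₂ a' ha using fun i => Types.jointly_surjective_of_isColimit
    (isColimitOfPreserves (actionFunctor Lab) hc) (a i)
  let m := IsCardinalFiltered.max (κ := (ℵ₁ : Cardinal.{u})) (Sum.elim j₁ j₂)
    (hasCardinalLT_aleph_one _)
  let t := IsCardinalFiltered.toMax (κ := (ℵ₁ : Cardinal.{u})) (Sum.elim j₁ j₂)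
    (hasCardinalLT_aleph_one _)
  exact ⟨m, fun i => (toHom (F.map (t (.inl i)))).onState (s' i),
    fun i => (toHom (F.map (t (.inr i)))).onAction (a' i),
    fun i => (onState_w (t (.inl i)) (s' i)).trans (hs i),
    fun i => (onAction_w (t (.inr i)) (a' i)).trans (ha i)⟩

lemma exists_map_onAction_eq {j : J} {l l' : List (F.obj j).toWTS.Action}
    (h : l.map (toHom (c.ι.app j)).onAction = l'.map (toHom (c.ι.app j)).onAction) :
    ∃ (k : J) (f : j ⟶ k),
      l.map (toHom (F.map f)).onAction = l'.map (toHom (F.map f)).onAction := by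
  obtain ⟨k, f, hf⟩ := exists_forall_of_forall_exists j
    (fun (i : ℕ) k f => l[i]?.map (toHom (F.map f)).onAction =
      l'[i]?.map (toHom (F.map f)).onAction)
    (fun i k m f g hf => by
      have := congrArg (Option.map (toHom (F.map g)).onAction) hf
      simpa only [Option.map_map, Function.comp_def, ← onAction_map_comp] using this)
    (fun i => by
      have hi : (l.map (toHom (c.ι.app j)).onAction)[i]? =
        (l'.map (toHom (c.ι.app j)).onAction)[i]? := by rw [h]
      rw [List.getElem?_map, List.getElem?_map] at hi
      generalize l[i]? = a, l'[i]? = a' at hi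
      rcases a with _ | a <;> rcases a' with _ | a'
      · exact ⟨j, 𝟙 j, rfl⟩
      · simp at hi
      · simp at hi
      · obtain ⟨k, f, hf⟩ := (onAction_eq_iff hc a a').1 (by simpa using hi)
        exact ⟨k, f, congrArg some hf⟩)
  exact ⟨k, f, List.ext_getElem? fun i => by simpa only [List.getElem?_map] using hf i⟩

/-- A tuple of the `j`-th object of an `ℵ₁`-filtered diagram with the same image in the colimit as
a transition of the `i`-th object becomes a transition at a later stage. -/
lemma exists_trans_of_image {i j : J} {α' β' : (F.obj i).toWTS.State}
    {l' : List (F.obj i).toWTS.Action} (h : (F.obj i).toWTS.Trans α' l' β')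
    {α β : (F.obj j).toWTS.State} {l : List (F.obj j).toWTS.Action}
    (hα : (toHom (c.ι.app i)).onState α' = (toHom (c.ι.app j)).onState α)
    (hl : l'.map (toHom (c.ι.app i)).onAction = l.map (toHom (c.ι.app j)).onAction)
    (hβ : (toHom (c.ι.app i)).onState β' = (toHom (c.ι.app j)).onState β) :
    ∃ (k : J) (f : j ⟶ k), (F.obj k).toWTS.Trans ((toHom (F.map f)).onState α)
      (l.map (toHom (F.map f)).onAction) ((toHom (F.map f)).onState β) := by
  have := isFiltered_of_isCardinalFiltered J (ℵ₁ : Cardinal.{u})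
  let p := IsFiltered.leftToMax i j
  let q := IsFiltered.rightToMax i j
  -- Going from `i` and `j` to ever later stages, identify the sources, the targets and then the
  -- lists of actions of the two tuples.
  obtain ⟨k₁, f₁, h₁⟩ := (onState_eq_iff hc ((toHom (F.map p)).onState α')
    ((toHom (F.map q)).onState α)).1 (by rw [onState_w, onState_w, hα])
  obtain ⟨k₂, f₂, h₂⟩ := (onState_eq_iff hc ((toHom (F.map (p ≫ f₁))).onState β')
    ((toHom (F.map (q ≫ f₁))).onState β)).1 (by rw [onState_w, onState_w, hβ])
  obtain ⟨k₃, f₃, h₃⟩ := exists_map_onAction_eq hc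
    (l := l'.map (toHom (F.map ((p ≫ f₁) ≫ f₂))).onAction)
    (l' := l.map (toHom (F.map ((q ≫ f₁) ≫ f₂))).onAction)
    (by rw [map_onAction_w, map_onAction_w, hl])
  refine ⟨k₃, ((q ≫ f₁) ≫ f₂) ≫ f₃, ?_⟩
  have h₄ := (toHom (F.map (((p ≫ f₁) ≫ f₂) ≫ f₃))).map_trans h
  rw [map_onAction_map_comp, h₃, ← map_onAction_map_comp, onState_map_comp _ f₃,
    onState_map_comp _ f₂, onState_map_comp p, h₁, ← onState_map_comp, ← onState_map_comp,
    ← onState_map_comp, onState_map_comp _ f₃, onState_map_comp _ f₂, h₂, ← onState_map_comp,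
    ← onState_map_comp] at h₄
  simpa only [Category.assoc] using h₄

end

lemma exists_perm_map_eq {A B : Type*} {f : A → B} {l : List A} {m : List B}
    (h : (l.map f).Perm m) : ∃ l', l.Perm l' ∧ l'.map f = m := by
  obtain ⟨l', h₁, h₂⟩ := List.perm_comp_forall₂ (r := fun b a => b = f a) (v := l) h.symm
    (by simp [List.forall₂_map_left_iff, List.forall₂_same])
  refine ⟨l', h₂.symm, ?_⟩
  rw [← List.forall₂_map_right_iff, List.forall₂_eq_eq_eq] at h₁
  exact h₁.symm

lemma exists_trans_of_imageTrans [IsCardinalFiltered J (ℵ₁ : Cardinal.{u})] {j : J}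
    {α β : (F.obj j).toWTS.State} {l : List (F.obj j).toWTS.Action}
    (h : ImageTrans F (mkState F j α) (l.map (mkAction F j)) (mkState F j β)) :
    ∃ (k : J) (f : j ⟶ k), (F.obj k).toWTS.Trans ((toHom (F.map f)).onState α)
      (l.map (toHom (F.map f)).onAction) ((toHom (F.map f)).onState β) := by
  generalize hα : mkState F j α = α₀, hl : l.map (mkAction F j) = l₀,
    hβ : mkState F j β = β₀ at h
  obtain ⟨h⟩ := h
  exact exists_trans_of_image (isColimitColimitCocone F) h hα.symm hl.symm hβ.symm

/-- In an `ℵ₁`-filtered colimit the images of the transitions are closed under the multiset and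
the patching axioms, because a patching configuration involves finitely many states and actions. -/
lemma imageTrans_of_generated [IsCardinalFiltered J (ℵ₁ : Cardinal.{u})] {α l β}
    (h : WTS.Generated (ImageTrans F) α l β) : ImageTrans F α l β := by
  induction h with
  | of h => exact h
  | multiset p _ ih =>
    obtain ⟨h⟩ := ih
    obtain ⟨l', hl', rfl⟩ := exists_perm_map_eq p
    exact ⟨(F.obj _).toWTS.multiset hl' h⟩
  | @patching α β ν₁ ν₂ x y z hx hy hz _ _ _ _ _ h₁ h₂ h₃ h₄ h₅ =>
    have hc := isColimitColimitCocone F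
    obtain ⟨j, s, a, hs, ha⟩ := exists_stage hc ![α, β, ν₁, ν₂]
      (x ++ y ++ z).get
    have lift (w : List (Quot (ActionRel F))) (hw : w ⊆ x ++ y ++ z) :
        ∃ w' : List (F.obj j).toWTS.Action, w'.map (mkAction F j) = w := by
      have : w ∈ Set.range (List.map (mkAction F j)) := by
        rw [Set.range_list_map]
        intro b hb
        obtain ⟨n, rfl⟩ := List.get_of_mem (hw hb)
        exact ⟨a n, ha n⟩
      exact this
    obtain ⟨x, rfl⟩ := lift x (by simp)
    obtain ⟨y, rfl⟩ := lift y (by simp)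
    obtain ⟨z, rfl⟩ := lift z (by simp)
    obtain rfl : mkState F j (s 0) = α := hs 0
    obtain rfl : mkState F j (s 1) = β := hs 1
    obtain rfl : mkState F j (s 2) = ν₁ := hs 2
    obtain rfl : mkState F j (s 3) = ν₂ := hs 3
    simp only [← List.map_append] at h₁ h₂ h₃ h₄ h₅
    obtain ⟨k, f, hf⟩ := exists_forall_of_forall_exists j
      (fun (i : Fin 5) k f => (F.obj k).toWTS.Trans
        ((toHom (F.map f)).onState (s (![0, 0, 2, 0, 3] i)))
        ((![x ++ y ++ z, x, y ++ z, x ++ y, z] i).map (toHom (F.map f)).onAction)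
        ((toHom (F.map f)).onState (s (![1, 2, 1, 3, 1] i))))
      (fun i k m f g h => by
        rw [onState_map_comp, onState_map_comp, map_onAction_map_comp]
        exact (toHom (F.map g)).map_trans h)
      (fun i => exists_trans_of_imageTrans (by fin_cases i <;> assumption))
    have h₁ : (F.obj k).toWTS.Trans ((toHom (F.map f)).onState (s 0))
        ((x ++ y ++ z).map (toHom (F.map f)).onAction) ((toHom (F.map f)).onState (s 1)) := hf 0
    have h₃ : (F.obj k).toWTS.Trans ((toHom (F.map f)).onState (s 2))
        ((y ++ z).map (toHom (F.map f)).onAction) ((toHom (F.map f)).onState (s 1)) := hf 2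
    have h₄ : (F.obj k).toWTS.Trans ((toHom (F.map f)).onState (s 0))
        ((x ++ y).map (toHom (F.map f)).onAction) ((toHom (F.map f)).onState (s 3)) := hf 3
    rw [List.map_append] at h₁ h₃ h₄
    rw [List.map_append] at h₁
    have h := (F.obj k).toWTS.patching (by simpa using hx) (by simpa using hy) (by simpa using hz)
      h₁ (hf 1) h₃ h₄ (hf 4)
    have hy' : (y.map (toHom (F.map f)).onAction).map (mkAction F k) = y.map (mkAction F j) :=
      map_onAction_w (c := colimitCocone F) f y
    rw [← mkState_map F f, ← mkState_map F f (s 3), ← hy']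
    exact ⟨h⟩

/-- A tuple of an object of an `ℵ₁`-filtered diagram which becomes a transition in the colimit
becomes one at a later stage. -/
lemma exists_trans_of_trans [IsCardinalFiltered J (ℵ₁ : Cardinal.{u})] {c : Cocone F}
    (hc : IsColimit c) {j : J} {α β : (F.obj j).toWTS.State} {l : List (F.obj j).toWTS.Action}
    (h : c.pt.toWTS.Trans ((toHom (c.ι.app j)).onState α) (l.map (toHom (c.ι.app j)).onAction)
      ((toHom (c.ι.app j)).onState β)) :
    ∃ (k : J) (f : j ⟶ k), (F.obj k).toWTS.Trans ((toHom (F.map f)).onState α)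
      (l.map (toHom (F.map f)).onAction) ((toHom (F.map f)).onState β) := by
  have h' := (toHom (hc.desc (colimitCocone F))).map_trans h
  have hS (s) : (toHom (hc.desc (colimitCocone F))).onState ((toHom (c.ι.app j)).onState s) =
      mkState F j s :=
    congrArg (fun g => (toHom g).onState s) (hc.fac (colimitCocone F) j)
  have hA : (toHom (hc.desc (colimitCocone F))).onAction ∘ (toHom (c.ι.app j)).onAction =
      mkAction F j :=
    congrArg (fun g => (toHom g).onAction) (hc.fac (colimitCocone F) j)
  rw [hS, hS, List.map_map, hA] at h'
  exact exists_trans_of_imageTrans (imageTrans_of_generated h')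

end FilteredColimits

open Limits Cardinal

/-! ### Countable systems -/

/-- A star-shaped system with countably many states and actions is `ℵ₁`-presentable: being a
morphism out of it amounts to countably many conditions, as it has countably many transitions. -/
lemma isCardinalPresentable_of_countable (X : StarWTS Lab) [Countable X.toWTS.State]
    [Countable X.toWTS.Action] : IsCardinalPresentable X (ℵ₁ : Cardinal.{u}) where
  preservesColimitOfShape J _ _ := ⟨fun {F} => ⟨fun {c} hc => ⟨by
    have := isFiltered_of_isCardinalFiltered J (ℵ₁ : Cardinal.{u})
    refine Types.FilteredColimit.isColimitOf' _ _ (fun f => ?_) (fun j f g h => ?_)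
    · change X ⟶ c.pt at f
      obtain ⟨j, s, a, hs, ha⟩ := exists_stage hc (toHom f).onState (toHom f).onAction
      -- The lifted maps form a morphism as soon as the countably many transitions, and the
      -- initial state (the index `none`), are preserved.
      obtain ⟨k, g, hg⟩ := exists_forall_of_forall_exists j
        (fun (t : Option {t : X.toWTS.State × List X.toWTS.Action × X.toWTS.State //
            X.toWTS.Trans t.1 t.2.1 t.2.2}) k g =>
          t.elim ((toHom (F.map g)).onState (s X.base) = (F.obj k).base) fun t =>
            (F.obj k).toWTS.Trans ((toHom (F.map g)).onState (s t.1.1))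
              ((t.1.2.1.map a).map (toHom (F.map g)).onAction)
              ((toHom (F.map g)).onState (s t.1.2.2)))
        (by
          rintro (_ | t) k m g g' h
          · change _ = _ at h ⊢
            rw [onState_map_comp, h, toHom_base]
          · change (F.obj m).toWTS.Trans _ _ _
            rw [onState_map_comp, onState_map_comp, map_onAction_map_comp]
            exact (toHom (F.map g')).map_trans h)
        (by
          rintro (_ | ⟨⟨α, l, β⟩, ht⟩)
          · obtain ⟨k, g, hg⟩ := (onState_eq_iff hc (s X.base) (F.obj j).base).1
              (by rw [hs, toHom_base, toHom_base]; rfl)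
            exact ⟨k, g, hg.trans (toHom_base _)⟩
          · refine exists_trans_of_trans hc ?_
            rw [hs, hs, List.map_map, show (toHom (c.ι.app j)).onAction ∘ a = _ from funext ha]
            exact (toHom f).map_trans ht)
      refine ⟨k, homMk
        { onState := fun x => (toHom (F.map g)).onState (s x)
          onAction := fun x => (toHom (F.map g)).onAction (a x)
          label_comp := fun x => by
            rw [WTS.Hom.label_comp, ← (toHom f).label_comp, ← ha, WTS.Hom.label_comp]
          map_trans := fun {α l β} ht => by
            have := hg (some ⟨(α, l, β), ht⟩)
            change (F.obj k).toWTS.Trans _ _ _ at this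
            rwa [List.map_map] at this } (hg none), ?_⟩
      exact hom_ext (fun x => ((onState_w g (s x)).trans (hs x)).symm)
        (fun x => ((onAction_w g (a x)).trans (ha x)).symm)
    · change X ⟶ F.obj j at f g
      replace h : f ≫ c.ι.app j = g ≫ c.ι.app j := h
      obtain ⟨k, m, hm⟩ := exists_forall_of_forall_exists j
        (fun (x : X.toWTS.State ⊕ X.toWTS.Action) k m =>
          x.elim (fun x => (toHom (F.map m)).onState ((toHom f).onState x) =
              (toHom (F.map m)).onState ((toHom g).onState x))
            fun x => (toHom (F.map m)).onAction ((toHom f).onAction x) =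
              (toHom (F.map m)).onAction ((toHom g).onAction x))
        (by
          rintro (x | x) k m p q h
          · change _ = _ at h ⊢
            rw [onState_map_comp, h, ← onState_map_comp]
          · change _ = _ at h ⊢
            rw [onAction_map_comp, h, ← onAction_map_comp])
        (by
          rintro (x | x)
          · exact (onState_eq_iff hc _ _).1 (congrArg (fun g => (toHom g).onState x) h)
          · exact (onAction_eq_iff hc _ _).1 (congrArg (fun g => (toHom g).onAction x) h))
      exact ⟨k, m, hom_ext (fun x => hm (.inl x)) fun x => hm (.inr x)⟩⟩⟩⟩

variable (Lab) in
/-- The star-shaped systems with countably many states and actions. -/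
def isCountable : ObjectProperty (StarWTS Lab) :=
  fun X => Countable X.toWTS.State ∧ Countable X.toWTS.Action

/-- The codes of countable systems: an initial state, labels and transitions on sets of natural
numbers. -/
abbrev Code (Lab : Type u) : Type u :=
  Σ (S : Set ℕ) (A : Set ℕ), S × (A → Lab) × (S → List A → S → Prop)

/-- A code describes a system if the two agree under some numbering of states and actions. -/
def Code.Describes (d : Code Lab) (X : StarWTS Lab) : Prop :=
  ∃ (eS : d.1 ≃ X.toWTS.State) (eA : d.2.1 ≃ X.toWTS.Action), eS d.2.2.1 = X.base ∧
    (∀ a, X.toWTS.label (eA a) = d.2.2.2.1 a) ∧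
    ∀ α l β, X.toWTS.Trans (eS α) (l.map eA) (eS β) ↔ d.2.2.2.2 α l β

lemma Code.Describes.nonempty_iso {d : Code Lab} {X Y : StarWTS Lab} (hX : d.Describes X)
    (hY : d.Describes Y) : Nonempty (X ≅ Y) := by
  have key {X Y : StarWTS Lab} {eS : d.1 ≃ X.toWTS.State} {eA : d.2.1 ≃ X.toWTS.Action}
      {eS' : d.1 ≃ Y.toWTS.State} {eA' : d.2.1 ≃ Y.toWTS.Action}
      (h₁ : eS d.2.2.1 = X.base) (h₁' : eS' d.2.2.1 = Y.base)
      (h₂ : ∀ a, X.toWTS.label (eA a) = d.2.2.2.1 a)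
      (h₂' : ∀ a, Y.toWTS.label (eA' a) = d.2.2.2.1 a)
      (h₃ : ∀ α l β, X.toWTS.Trans (eS α) (l.map eA) (eS β) ↔ d.2.2.2.2 α l β)
      (h₃' : ∀ α l β, Y.toWTS.Trans (eS' α) (l.map eA') (eS' β) ↔ d.2.2.2.2 α l β) :
      ∃ f : X ⟶ Y, (∀ s, (toHom f).onState s = eS' (eS.symm s)) ∧
        ∀ a, (toHom f).onAction a = eA' (eA.symm a) :=
    ⟨homMk
      { onState := fun s => eS' (eS.symm s)
        onAction := fun a => eA' (eA.symm a)
        label_comp := fun a => by rw [h₂', ← h₂, eA.apply_symm_apply]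
        map_trans := fun {α l β} h => by
          have h' := (h₃' (eS.symm α) (l.map eA.symm) (eS.symm β)).2
            ((h₃ _ _ _).1 (by simpa using h))
          rwa [List.map_map] at h' } (by
      change eS' (eS.symm _) = _
      rw [← h₁, eS.symm_apply_apply, h₁']), fun _ => rfl, fun _ => rfl⟩
  obtain ⟨eS, eA, h₁, h₂, h₃⟩ := hX
  obtain ⟨eS', eA', h₁', h₂', h₃'⟩ := hY
  obtain ⟨f, hf, hf'⟩ := key h₁ h₁' h₂ h₂' h₃ h₃'
  obtain ⟨g, hg, hg'⟩ := key h₁' h₁ h₂' h₂ h₃' h₃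
  exact ⟨⟨f, g, hom_ext (fun _ => by simp [hf, hg]) (fun _ => by simp [hf', hg']),
    hom_ext (fun _ => by simp [hf, hg]) (fun _ => by simp [hf', hg'])⟩⟩

instance : ObjectProperty.EssentiallySmall.{u} (isCountable Lab) where
  exists_small_le' := by
    refine ⟨.ofObj fun d : {d : Code Lab // ∃ X, d.Describes X} => d.2.choose, inferInstance, ?_⟩
    rintro X ⟨_, _⟩
    obtain ⟨f, hf⟩ := exists_injective_nat X.toWTS.State
    obtain ⟨g, hg⟩ := exists_injective_nat X.toWTS.Action
    let eS := (Equiv.ofInjective f hf).symm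
    let eA := (Equiv.ofInjective g hg).symm
    let d : Code Lab := ⟨Set.range f, Set.range g, eS.symm X.base, fun a => X.toWTS.label (eA a),
      fun α l β => X.toWTS.Trans (eS α) (l.map eA) (eS β)⟩
    have hd : d.Describes X :=
      ⟨eS, eA, eS.apply_symm_apply _, fun _ => rfl, fun _ _ _ => Iff.rfl⟩
    have hd' : ∃ X, d.Describes X := ⟨X, hd⟩
    exact ⟨_, ⟨⟨d, hd'⟩⟩, hd.nonempty_iso hd'.choose_spec⟩

/-! ### Every system is an `ℵ₁`-directed colimit of countable ones -/

/-- There is a transition of `X` from `γ` to `δ` whose states lie in `S` and whose actions lie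
in `A`. -/
def StepIn (X : StarWTS Lab) (S : Set X.toWTS.State) (A : Set X.toWTS.Action)
    (γ δ : X.toWTS.State) : Prop :=
  γ ∈ S ∧ δ ∈ S ∧ ∃ l : List X.toWTS.Action, (∀ a ∈ l, a ∈ A) ∧ X.toWTS.Trans γ l δ

/-- Countable sets of states and actions of `X` such that the full subsystem which they span is
star-shaped. -/
@[ext]
structure CountableSub (X : StarWTS Lab) where
  states : Set X.toWTS.State
  actions : Set X.toWTS.Action
  countable_states : states.Countable
  countable_actions : actions.Countable
  base_mem : X.base ∈ states
  reach : ∀ s ∈ states, Relation.ReflTransGen (X.StepIn states actions) X.base s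

lemma StepIn.mono {X : StarWTS Lab} {S S' : Set X.toWTS.State} {A A' : Set X.toWTS.Action}
    (hS : S ⊆ S') (hA : A ⊆ A') {γ δ} (h : X.StepIn S A γ δ) : X.StepIn S' A' γ δ :=
  ⟨hS h.1, hS h.2.1, h.2.2.imp fun _ hl => ⟨fun a ha => hA (hl.1 a ha), hl.2⟩⟩

lemma reflTransGen_stepIn_mono {X : StarWTS Lab} {S S' : Set X.toWTS.State}
    {A A' : Set X.toWTS.Action} (hS : S ⊆ S') (hA : A ⊆ A') {γ δ}
    (h : Relation.ReflTransGen (X.StepIn S A) γ δ) :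
    Relation.ReflTransGen (X.StepIn S' A') γ δ :=
  Relation.ReflTransGen.mono (fun _ _ => StepIn.mono hS hA) _ _ h

namespace CountableSub

variable {X : StarWTS Lab}

instance : PartialOrder (CountableSub X) :=
  PartialOrder.lift (fun Y => (Y.states, Y.actions)) fun _ _ h =>
    CountableSub.ext (congrArg Prod.fst h) (congrArg Prod.snd h)

/-- The union of countably many star-shaped subsystems, with countably many actions added. -/
def union {K : Type*} [Countable K] (Y : K → CountableSub X) (A : Set X.toWTS.Action)
    (hA : A.Countable) : CountableSub X where
  states := insert X.base (⋃ i, (Y i).states)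
  actions := A ∪ ⋃ i, (Y i).actions
  countable_states := (Set.countable_iUnion fun i => (Y i).countable_states).insert _
  countable_actions := hA.union (Set.countable_iUnion fun i => (Y i).countable_actions)
  base_mem := Set.mem_insert _ _
  reach s hs := by
    rcases hs with rfl | hs
    · exact .refl
    · obtain ⟨i, hi⟩ := Set.mem_iUnion.1 hs
      exact reflTransGen_stepIn_mono
        ((Set.subset_iUnion (fun i => (Y i).states) i).trans (Set.subset_insert _ _))
        ((Set.subset_iUnion (fun i => (Y i).actions) i).trans Set.subset_union_right)
        ((Y i).reach s hi)

lemma le_union {K : Type*} [Countable K] (Y : K → CountableSub X) (A : Set X.toWTS.Action)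
    (hA : A.Countable) (i : K) : Y i ≤ union Y A hA :=
  ⟨(Set.subset_iUnion (fun i => (Y i).states) i).trans (Set.subset_insert _ _),
    (Set.subset_iUnion (fun i => (Y i).actions) i).trans Set.subset_union_right⟩

/-- A state lies in the star-shaped subsystem spanned by a path which reaches it. -/
lemma exists_mem_states (s : X.toWTS.State) : ∃ Y : CountableSub X, s ∈ Y.states := by
  have h : Relation.ReflTransGen (fun γ δ => ∃ l, X.toWTS.Trans γ l δ) X.base s := X.property s
  induction h with
  | refl => exact ⟨union Empty.elim ∅ Set.countable_empty, Set.mem_insert _ _⟩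
  | @tail γ δ _ hl ih =>
    obtain ⟨Y, hY⟩ := ih
    obtain ⟨l, hl⟩ := hl
    have hS : Y.states ⊆ insert δ Y.states := Set.subset_insert _ _
    have hA : Y.actions ⊆ Y.actions ∪ {a | a ∈ l} := Set.subset_union_left
    refine ⟨⟨insert δ Y.states, Y.actions ∪ {a | a ∈ l}, Y.countable_states.insert _,
      Y.countable_actions.union (List.finite_toSet l).countable, hS Y.base_mem, ?_⟩,
      Set.mem_insert _ _⟩
    rintro s (rfl | hs)
    · exact (reflTransGen_stepIn_mono hS hA (Y.reach γ hY)).tail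
        ⟨hS hY, Set.mem_insert _ _, l, fun a ha => Or.inr ha, hl⟩
    · exact reflTransGen_stepIn_mono hS hA (Y.reach s hs)

lemma exists_subset (S : Set X.toWTS.State) (hS : S.Countable) (A : Set X.toWTS.Action)
    (hA : A.Countable) : ∃ Y : CountableSub X, S ⊆ Y.states ∧ A ⊆ Y.actions := by
  choose Y hY using exists_mem_states (X := X)
  have := hS.to_subtype
  exact ⟨union (fun s : S => Y s) A hA,
    fun s hs => (le_union (fun s : S => Y s) A hA ⟨s, hs⟩).1 (hY s), Set.subset_union_left⟩

instance : IsCardinalFiltered (CountableSub X) (ℵ₁ : Cardinal.{u}) :=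
  isCardinalFiltered_preorder _ _ fun K Y hK => by
    rw [lt_aleph_one_iff, mk_le_aleph0_iff] at hK
    exact ⟨union Y ∅ Set.countable_empty, le_union _ _ _⟩

/-- The full subsystem spanned by the given states and actions. -/
def toStar (Y : CountableSub X) : StarWTS Lab :=
  of (X.toWTS.induced (Subtype.val : Y.states → _) (Subtype.val : Y.actions → _))
    ⟨X.base, Y.base_mem⟩ (by
      rintro ⟨s, hs⟩
      have h := Y.reach s hs
      induction h with
      | refl => exact Relation.ReflTransGen.refl
      | tail _ h ih =>
        obtain ⟨h₁, h₂, l, hl, ht⟩ := h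
        lift l to List Y.actions using hl
        exact Relation.ReflTransGen.tail (ih h₁) ⟨l, ht⟩)

/-- The inclusion of one subsystem into another. -/
def inclusion {Y Z : CountableSub X} (h : Y ≤ Z) : Y.toStar ⟶ Z.toStar :=
  homMk
    { onState := Set.inclusion h.1
      onAction := Set.inclusion h.2
      label_comp := fun _ => rfl
      map_trans := fun {α l β} ht => by
        have e : ((l : List Y.actions).map (Set.inclusion h.2)).map Subtype.val =
          (l : List Y.actions).map Subtype.val := List.map_map ..
        exact (congrArg (fun m => X.toWTS.Trans (α : Y.states).1 m (β : Y.states).1) e).mpr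
          ht } rfl

variable (X) in
/-- The diagram of the countable star-shaped full subsystems. -/
def diagram : CountableSub X ⥤ StarWTS Lab where
  obj Y := Y.toStar
  map f := inclusion (leOfHom f)

variable (X) in
/-- The inclusions of the countable star-shaped full subsystems. -/
def cocone : Cocone (diagram X) where
  pt := X
  ι :=
    { app Y := homMk
        { onState := Subtype.val
          onAction := Subtype.val
          label_comp := fun _ => rfl
          map_trans := id } rfl }

section

variable (s : Cocone (diagram X))

lemma onState_congr {Y Z : CountableSub X} {x : X.toWTS.State} (hY : x ∈ Y.states)
    (hZ : x ∈ Z.states) :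
    (toHom (s.ι.app Y)).onState ⟨x, hY⟩ = (toHom (s.ι.app Z)).onState ⟨x, hZ⟩ := by
  have hW := le_union ![Y, Z] ∅ Set.countable_empty
  exact (onState_w (c := s) (homOfLE (hW 0)) (⟨x, hY⟩ : Y.states)).symm.trans
    (onState_w (c := s) (homOfLE (hW 1)) (⟨x, hZ⟩ : Z.states))

lemma onAction_congr {Y Z : CountableSub X} {a : X.toWTS.Action} (hY : a ∈ Y.actions)
    (hZ : a ∈ Z.actions) :
    (toHom (s.ι.app Y)).onAction ⟨a, hY⟩ = (toHom (s.ι.app Z)).onAction ⟨a, hZ⟩ := by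
  have hW := le_union ![Y, Z] ∅ Set.countable_empty
  exact (onAction_w (c := s) (homOfLE (hW 0)) (⟨a, hY⟩ : Y.actions)).symm.trans
    (onAction_w (c := s) (homOfLE (hW 1)) (⟨a, hZ⟩ : Z.actions))

lemma exists_mem_actions (a : X.toWTS.Action) : ∃ Y : CountableSub X, a ∈ Y.actions :=
  (exists_subset ∅ Set.countable_empty {a} (Set.countable_singleton a)).imp fun _ h => h.2 rfl

/-- The morphism out of `X` induced by compatible morphisms out of its countable star-shaped full
subsystems. A transition is preserved because some such subsystem contains it. -/
noncomputable def desc : X ⟶ s.pt :=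
  homMk
    { onState := fun x => (toHom (s.ι.app (exists_mem_states x).choose)).onState
        ⟨x, (exists_mem_states x).choose_spec⟩
      onAction := fun a => (toHom (s.ι.app (exists_mem_actions a).choose)).onAction
        ⟨a, (exists_mem_actions a).choose_spec⟩
      label_comp := fun a => (toHom (s.ι.app _)).label_comp _
      map_trans := fun {α l β} h => by
        obtain ⟨Y, hS, hA⟩ := exists_subset {α, β} (Set.toFinite _).countable {a | a ∈ l}
          (List.finite_toSet l).countable
        have hα : α ∈ Y.states := hS (by simp)
        have hβ : β ∈ Y.states := hS (by simp)
        lift l to List Y.actions using hA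
        have h' := (toHom (s.ι.app Y)).map_trans (α := ⟨α, hα⟩) (β := ⟨β, hβ⟩) (l := l) h
        rw [onState_congr s _ hα, onState_congr s _ hβ, List.map_map]
        rwa [List.map_congr_left fun a _ => onAction_congr s
          (exists_mem_actions a.1).choose_spec a.2] }
    ((onState_congr s _ (exists_mem_states X.base).choose.base_mem).trans (toHom_base (s.ι.app _)))

variable (X) in
/-- A star-shaped system is the colimit of its countable star-shaped full subsystems. -/
noncomputable def isColimitCocone : IsColimit (cocone X) where
  desc := desc
  fac s _ := hom_ext (fun x => onState_congr s _ x.2) (fun a => onAction_congr s _ a.2)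
  uniq s _ hm := hom_ext
    (fun x => congrArg (fun g : toStar (exists_mem_states x).choose ⟶ s.pt =>
      (toHom g).onState ⟨x, (exists_mem_states x).choose_spec⟩) (hm _))
    (fun a => congrArg (fun g : toStar (exists_mem_actions a).choose ⟶ s.pt =>
      (toHom g).onAction ⟨a, (exists_mem_actions a).choose_spec⟩) (hm _))

end

end CountableSub

variable (Lab) in
lemma isCardinalFilteredGenerator_isCountable :
    (isCountable Lab).IsCardinalFilteredGenerator (ℵ₁ : Cardinal.{u}) where
  le_isCardinalPresentable := by
    rintro X ⟨_, _⟩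
    exact isCardinalPresentable_of_countable X
  exists_colimitsOfShape X := ⟨CountableSub X, inferInstance, inferInstance,
    ⟨{  diag := _
        ι := _
        isColimit := CountableSub.isColimitCocone X
        prop_diag_obj := fun Y =>
          ⟨Y.countable_states.to_subtype, Y.countable_actions.to_subtype⟩ }⟩⟩

instance : IsCardinalLocallyPresentable (StarWTS Lab) (ℵ₁ : Cardinal.{u}) where
  toHasCardinalFilteredGenerator :=
    (isCardinalFilteredGenerator_isCountable Lab).hasCardinalFilteredGenerator

end StarWTS

theorem mainTheorem11 (Lab : Type u) [Nonempty Lab] :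
    IsLocallyPresentable.{u} (StarWTS Lab) := by
  exact ⟨Cardinal.aleph 1, inferInstance, inferInstance⟩
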